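/- Let $X$ be a complex Banach space, $L(X)$ the algebra of bounded linear operators on $X$, $F_0(X)$ and $K(X)$ its ideals of finite-rank and of compact operators, and $\pi:L(X)\to\mathcal C_0(X)=L(X)/F_0(X)$, $\Pi:L(X)\to\mathcal C(X)=L(X)/K(X)$ the natural projections. In a ring $A$ with unit $e$, let $\mathrm{comm}(a)=\{x\in A: xa=ax\}$ and $\mathrm{comm}^2(a)=\{x\in A: xy=yx\text{ for all }y\in\mathrm{comm}(a)\}$; call $a$ quasinilpotent if $e-xa$ is invertible for every $x\in\mathrm{comm}(a)$; and for an idempotent $p$ call $a$ left $p$-invertible if $ap=pa$ and $b(a+p)=e$ for some $b\in\mathrm{comm}(p)$. An idempotent $P\in L(X)$ is associated to $T\in L(X)$ in $\mathcal C_0(X)$ if $\pi(P)\in\mathrm{comm}^2(\pi(T))$, $\pi(P)\pi(T)$ is quasinilpotent and $\pi(T)$ is left $\pi(P)$-invertible in $\mathcal C_0(X)$; $\pi(T)$ is left generalized Drazin invertible in $\mathcal C_0(X)$ if such a $P$ exists. An idempotent $P\in L(X)$ is associated to $T$ in $\mathcal C(X)$ if $\Pi(P)\in\mathrm{comm}(\Pi(T))$,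 $\Pi(P)\Pi(T)$ is quasinilpotent and $\Pi(T)$ is left $\Pi(P)$-invertible in $\mathcal C(X)$; $T$ is left pseudo semi-B-Fredholm if such a $P$ exists. An operator on a Banach space is left semi-Fredholm if its null space is finite-dimensional and its range is closed and is the range of a bounded projection; an operator $S$ is Riesz if $S-\mu I$ is Fredholm for every $\mu\in\mathbb C\setminus\{0\}$. An operator $R\in L(X)$ is Riesz-left semi-Fredholm if $X=M\oplus N$ with $M,N$ closed and $R$-invariant, $R_{|M}$ Riesz and $R_{|N}$ left semi-Fredholm. For an idempotent $P\in L(X)$ put $X_1=R(P)$, $X_2=R(I-P)=N(P)$, $T_1=(PTP)_{|X_1}\in L(X_1)$ and $T_2=((I-P)T(I-P))_{|X_2}\in L(X_2)$. **Theorem.** Let $T\in L(X)$. The following are equivalent: 1. $\pi(T)$ is left generalized Drazin invertible in $\mathcal C_0(X)$. 2. $T$ is left pseudo semi-B-Fredholm, and there is an idempotent $P\in L(X)$ associated to $T$ in $\mathcal C(X)$ such that $\pi(P)\in\mathrm{comm}^2(\pi(T))$. 3. There is an idempotent $P\in L(X)$ such that $\pi(P)\in\mathrm{comm}^2(\pi(T))$,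 $T_1$ is a Riesz operator and $T_2$ is a left semi-Fredholm operator. If these conditions hold, then $T=R+F$ with $F\in L(X)$ of finite rank and $R\in L(X)$ Riesz-left semi-Fredholm. -/

import Mathlib

/-! Fredholm-type operators on a complex Banach space `X`, seen through the quotients of `L(X)` by the
finite-rank operators and by the compact operators. Here `L(X)` is `X →L[ℂ] X`, whose product is
composition. -/

namespace FredholmType

section RingNotions

variable {A : Type*} [Ring A]

/-- The commutant `comm(a) = {x | x a = a x}`. -/
def commutant (a : A) : Set A := {x | x * a = a * x}

/-- The bicommutant `comm²(a) = {x | x y = y x for all y ∈ comm(a)}`. -/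
def bicommutant (a : A) : Set A := {x | ∀ y ∈ commutant a, x * y = y * x}

/-- Quasinilpotent element of a unital ring: `1 - x a` is invertible for every `x` commuting
with `a`. -/
def IsQuasinilpotent (a : A) : Prop := ∀ x ∈ commutant a, IsUnit (1 - x * a)

/-- `a` is left `p`-invertible: `a p = p a` and `a + p` has a left inverse in the subring
`{x | x p = p x}`. (The notion is used for idempotent `p`.) -/
def IsLeftPInvertible (a p : A) : Prop :=
  a * p = p * a ∧ ∃ b ∈ commutant p, b * (a + p) = 1

end RingNotions

section Quotients

variable (X : Type*) [NormedAddCommGroup X] [NormedSpace ℂ X]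

/-- The ideal `F₀(X)` of (bounded) finite-rank operators. -/
def finiteRankIdeal : Ideal (X →L[ℂ] X) where
  carrier := {T | FiniteDimensional ℂ T.range}
  zero_mem' := by
    have h : (0 : X →L[ℂ] X).range ≤ ⊥ := by
      rintro _ ⟨x, rfl⟩
      simp
    exact Submodule.finiteDimensional_of_le h
  add_mem' {S T} hS hT := by
    have _ : FiniteDimensional ℂ S.range := hS
    have _ : FiniteDimensional ℂ T.range := hT
    have h : (S + T).range ≤ S.range ⊔ T.range := by
      rintro _ ⟨x, rfl⟩
      exact Submodule.add_mem_sup ⟨x, rfl⟩ ⟨x, rfl⟩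
    exact Submodule.finiteDimensional_of_le h
  smul_mem' R T hT := by
    have _ : FiniteDimensional ℂ T.range := hT
    have h : (R * T).range ≤ T.range.map (R : X →ₗ[ℂ] X) := by
      rintro _ ⟨x, rfl⟩
      exact ⟨T x, ⟨x, rfl⟩, rfl⟩
    exact Submodule.finiteDimensional_of_le h

instance finiteRankIdeal_isTwoSided : (finiteRankIdeal X).IsTwoSided where
  mul_mem_of_left {T} R hT := by
    have _ : FiniteDimensional ℂ T.range := hT
    have h : (T * R).range ≤ T.range := by
      rintro _ ⟨x, rfl⟩
      exact ⟨R x, rfl⟩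
    exact Submodule.finiteDimensional_of_le h

/-- The ideal `K(X)` of compact operators. -/
def compactIdeal : Ideal (X →L[ℂ] X) where
  carrier := {T | IsCompactOperator T}
  zero_mem' := isCompactOperator_zero
  add_mem' hS hT := hS.add hT
  smul_mem' R _ hT := hT.clm_comp R

instance compactIdeal_isTwoSided : (compactIdeal X).IsTwoSided where
  mul_mem_of_left R hT := hT.comp_clm R

/-- The algebra `C₀(X) = L(X) / F₀(X)`. -/
abbrev CalkinZero : Type _ := (X →L[ℂ] X) ⧸ finiteRankIdeal X

/-- The Calkin algebra `C(X) = L(X) / K(X)`. -/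
abbrev Calkin : Type _ := (X →L[ℂ] X) ⧸ compactIdeal X

variable {X}

/-- The natural projection `π : L(X) → C₀(X)`. -/
def piZero : (X →L[ℂ] X) →+* CalkinZero X := Ideal.Quotient.mk (finiteRankIdeal X)

/-- The natural projection `Π : L(X) → C(X)`. -/
def piCalkin : (X →L[ℂ] X) →+* Calkin X := Ideal.Quotient.mk (compactIdeal X)

end Quotients

section Operators

variable {X : Type*} [NormedAddCommGroup X] [NormedSpace ℂ X]

/-- `T` has finite rank. -/
def IsFiniteRank (T : X →L[ℂ] X) : Prop := FiniteDimensional ℂ T.range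

/-- Upper semi-Fredholm operator: closed range and finite-dimensional null space. -/
def IsUpperSemiFredholm (T : X →L[ℂ] X) : Prop :=
  IsClosed (T.range : Set X) ∧ FiniteDimensional ℂ T.ker

/-- Left semi-Fredholm operator: upper semi-Fredholm, and there is a bounded projection onto the
range. -/
def IsLeftSemiFredholm (T : X →L[ℂ] X) : Prop :=
  IsUpperSemiFredholm T ∧ T.range.ClosedComplemented

/-- Riesz operator: `T - μ I` is Fredholm for every nonzero complex number `μ`. -/
def IsRiesz (T : X →L[ℂ] X) : Prop :=
  ∀ μ : ℂ, μ ≠ 0 → (T - μ • (1 : X →L[ℂ] X)).IsFredholm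

/-- The operator `(P T P)` restricted to the range of `P`, as an operator on the range of `P`.
For an idempotent `P`, this is `T₁` for `P` itself, and `T₂` is obtained from `1 - P`, whose range
is the null space of `P`. -/
def compression (P T : X →L[ℂ] X) : P.range →L[ℂ] P.range :=
  (P * T * P).restrict (p := P.range) (q := P.range) fun x _ => ⟨T (P x), rfl⟩

/-- `T` is Riesz-left semi-Fredholm: `X = M ⊕ N` with `M`, `N` closed and `T`-invariant, `T` being
Riesz on `M` and left semi-Fredholm on `N`. -/
def IsRieszLeftSemiFredholm (T : X →L[ℂ] X) : Prop :=
  ∃ (M N : Submodule ℂ X) (hM : ∀ x ∈ M, T x ∈ M) (hN : ∀ x ∈ N, T x ∈ N),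
    IsClosed (M : Set X) ∧ IsClosed (N : Set X) ∧ IsCompl M N ∧
      IsRiesz (T.restrict hM) ∧ IsLeftSemiFredholm (T.restrict hN)

/-- The idempotent `P` is associated to `T` in `C₀(X)` (for left generalized Drazin
invertibility). -/
structure IsLeftAssociatedZero (T P : X →L[ℂ] X) : Prop where
  idem : P * P = P
  mem_bicommutant : piZero P ∈ bicommutant (piZero T)
  quasinilpotent : IsQuasinilpotent (piZero P * piZero T)
  leftInvertible : IsLeftPInvertible (piZero T) (piZero P)

/-- `π(T)` is left generalized Drazin invertible in `C₀(X)`. -/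
def IsLeftGenDrazinZero (T : X →L[ℂ] X) : Prop :=
  ∃ P : X →L[ℂ] X, IsLeftAssociatedZero T P

/-- The idempotent `P` is associated to `T` in the Calkin algebra `C(X)` (for left generalized
Drazin invertibility); here only `Π(P) ∈ comm(Π(T))` is asked. -/
structure IsLeftAssociatedCalkin (T P : X →L[ℂ] X) : Prop where
  idem : P * P = P
  mem_commutant : piCalkin P ∈ commutant (piCalkin T)
  quasinilpotent : IsQuasinilpotent (piCalkin P * piCalkin T)
  leftInvertible : IsLeftPInvertible (piCalkin T) (piCalkin P)

/-- `T` is left pseudo semi-B-Fredholm: `Π(T)` is left generalized Drazin invertible in the Calkin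
algebra. -/
def IsLeftPseudoSemiBFredholm (T : X →L[ℂ] X) : Prop :=
  ∃ P : X →L[ℂ] X, IsLeftAssociatedCalkin T P

end Operators

end FredholmType

namespace FredholmType

/-! Everything is reduced to invertibility modulo `F₀(X)`, one idempotent `P` at a time.

Since `F₀(X)` need not be closed, `C₀(X)` lacks the spectral theory of a Banach algebra. Atkinson's
theorem (`isUnit_piZero_iff_isUnit_piCalkin`) repairs this: `C₀(X)` and `C(X)` have the same
invertible classes. Hence in both quotients the class of `A` is quasinilpotent exactly when `A - μ`
is invertible modulo `F₀(X)` for all `μ ≠ 0`; the spectral radius formula in `C(X)` gives the hard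
direction. A left inverse in `C(X)` also lifts to `C₀(X)`. This gives 1 ↔ 2.

For 1 ↔ 3 (`isLeftAssociatedZero_iff`), `π(P)` commutes with `π(T)`, so `T` is `T₁ ⊕ T₂` up to
finite rank. Then `PT - μ` is `(T₁ - μ) ⊕ (-μ)`, so quasinilpotence says that `T₁` is Riesz; and `T
+ P` is `(T₁ + 1) ⊕ T₂`, where `T₁ + 1` is Fredholm for Riesz `T₁`, so left invertibility concerns
`T₂` alone. Left semi-Fredholm means left invertible modulo `F₀`. The decomposition `T = R + F` is
the same block form. -/

open scoped ENNReal NNReal in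
/-- In a complex Banach algebra, an element whose spectrum contains no nonzero number is
quasinilpotent. -/
theorem isQuasinilpotent_of_forall_isUnit_sub {B : Type*} [NormedRing B] [NormedAlgebra ℂ B]
    [CompleteSpace B] {a : B} (h : ∀ μ : ℂ, μ ≠ 0 → IsUnit (a - μ • (1 : B))) :
    IsQuasinilpotent a := by
  intro x hx
  have hcomm : Commute x a := hx
  have hr : spectralRadius ℂ a = 0 := by
    refine le_antisymm (iSup₂_le fun μ hμ => ?_) zero_le
    by_cases h0 : μ = 0
    · simp [h0]
    · refine absurd ?_ hμ
      have := (h μ h0).neg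
      rwa [neg_sub, ← Algebra.algebraMap_eq_smul_one] at this
  have hlim := spectrum.pow_nnnorm_pow_one_div_tendsto_nhds_spectralRadius a
  rw [hr] at hlim
  -- The `+ 1` keeps `c` defined when `x = 0`; `‖a ^ n‖ < c ^ n` then forces `‖(x a) ^ n‖ < 1`.
  set c : ℝ≥0 := (‖x‖₊ + 1)⁻¹ with hc
  have hc0 : (0 : ℝ≥0∞) < c := by
    rw [ENNReal.coe_pos]; positivity
  obtain ⟨n, hn, hn1⟩ := ((hlim.eventually (gt_mem_nhds hc0)).and
    (Filter.eventually_ge_atTop 1)).exists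
  have hn' : ‖a ^ n‖₊ < c ^ n := by
    have hpos : (0 : ℝ) < n := by exact_mod_cast hn1
    have := ENNReal.rpow_lt_rpow hn hpos
    rw [← ENNReal.rpow_mul, one_div_mul_cancel hpos.ne', ENNReal.rpow_one,
      ENNReal.rpow_natCast] at this
    exact_mod_cast this
  have hlt : ‖(x * a) ^ n‖₊ < 1 := by
    rw [hcomm.mul_pow]
    calc ‖x ^ n * a ^ n‖₊ ≤ ‖x ^ n‖₊ * ‖a ^ n‖₊ := nnnorm_mul_le _ _
      _ ≤ ‖x‖₊ ^ n * ‖a ^ n‖₊ := by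
        gcongr
        exact nnnorm_pow_le' x (by omega)
      _ ≤ (‖x‖₊ + 1) ^ n * ‖a ^ n‖₊ := by gcongr; simp
      _ < (‖x‖₊ + 1) ^ n * c ^ n := by gcongr
      _ = 1 := by rw [← mul_pow, hc, mul_inv_cancel₀ (by positivity), one_pow]
  have hu : IsUnit (1 - (x * a) ^ n) := isUnit_one_sub_of_norm_lt_one (by exact_mod_cast hlt)
  have hfac := mul_neg_geom_sum (x * a) n
  -- `1 - x a` is a factor of the unit `1 - (x a) ^ n`, and it commutes with the geometric sum.
  refine (Commute.isUnit_mul_iff (a := 1 - x * a)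
    (b := ∑ i ∈ Finset.range n, (x * a) ^ i) ?_).1 (hfac.symm ▸ hu) |>.1
  exact (hfac.trans (geom_sum_mul_neg (x * a) n).symm)

/-! ### Quotients of Banach algebras by closed ideals -/

section QuotientNorm

variable {A : Type*} [NormedRing A] (I : Ideal A) [I.IsTwoSided]

/-- The quotient of a normed ring by a closed two-sided ideal. -/
@[reducible] noncomputable def quotientNormedRing (hI : IsClosed (I : Set A)) :
    NormedRing (A ⧸ I) :=
  haveI : IsClosed (I : Set A) := hI
  { Submodule.Quotient.normedAddCommGroup I, Ideal.Quotient.ring I with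
    norm_mul_le := fun x y => by
      refine le_of_forall_pos_le_add fun ε hε => ?_
      -- Representatives nearly attain the quotient norms; continuity of the product at `(‖x‖, ‖y‖)`
      -- absorbs the error.
      have hlim := ((continuous_mul.tendsto (‖x‖, ‖y‖)).eventually
        (gt_mem_nhds (lt_add_of_pos_right (‖x‖ * ‖y‖) hε)))
      obtain ⟨δ, hδ, hball⟩ := Metric.eventually_nhds_iff.1 hlim
      obtain ⟨a, rfl, ha⟩ := Submodule.Quotient.norm_mk_lt x hδ
      obtain ⟨b, rfl, hb⟩ := Submodule.Quotient.norm_mk_lt y hδ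
      have ha' : ‖(Submodule.Quotient.mk a : A ⧸ I)‖ ≤ ‖a‖ := Submodule.Quotient.norm_mk_le I a
      have hb' : ‖(Submodule.Quotient.mk b : A ⧸ I)‖ ≤ ‖b‖ := Submodule.Quotient.norm_mk_le I b
      have hdist : dist (‖a‖, ‖b‖)
          (‖(Submodule.Quotient.mk a : A ⧸ I)‖, ‖(Submodule.Quotient.mk b : A ⧸ I)‖) < δ := by
        rw [Prod.dist_eq, max_lt_iff, Real.dist_eq, Real.dist_eq, abs_lt, abs_lt]
        exact ⟨⟨by linarith, by linarith⟩, ⟨by linarith, by linarith⟩⟩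
      exact ((Submodule.Quotient.norm_mk_le I (a * b)).trans (norm_mul_le a b)).trans
        (hball hdist).le }

/-- The quotient of a normed algebra by a closed two-sided ideal. -/
@[reducible] noncomputable def quotientNormedAlgebra [NormedAlgebra ℂ A]
    (hI : IsClosed (I : Set A)) :
    @NormedAlgebra ℂ (A ⧸ I) _ (quotientNormedRing I hI).toSeminormedRing :=
  let := quotientNormedRing I hI
  { Submodule.Quotient.normedSpace I ℂ, Ideal.Quotient.algebra ℂ with }

/-- In the quotient of a complex Banach algebra by a closed two-sided ideal, an element whose
spectrum contains no nonzero number is quasinilpotent. -/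
theorem isQuasinilpotent_quotient_of_forall_isUnit_sub [NormedAlgebra ℂ A] [CompleteSpace A]
    (hI : IsClosed (I : Set A)) {a : A}
    (h : ∀ μ : ℂ, μ ≠ 0 → IsUnit (Ideal.Quotient.mk I (a - μ • (1 : A)))) :
    IsQuasinilpotent (Ideal.Quotient.mk I a) := by
  let := quotientNormedRing I hI
  let := quotientNormedAlgebra I hI
  have : CompleteSpace (A ⧸ I) := Submodule.Quotient.completeSpace I
  exact isQuasinilpotent_of_forall_isUnit_sub (B := A ⧸ I) fun μ hμ => h μ hμ

end QuotientNorm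

/-! ### Left semi-Fredholm operators as left inverses modulo finite rank -/

variable {X : Type*} [NormedAddCommGroup X] [NormedSpace ℂ X]

theorem piZero_eq_iff {S T : X →L[ℂ] X} : piZero S = piZero T ↔ S - T ∈ finiteRankIdeal X :=
  Ideal.Quotient.mk_eq_mk_iff_sub_mem S T

theorem piCalkin_eq_iff {S T : X →L[ℂ] X} : piCalkin S = piCalkin T ↔ S - T ∈ compactIdeal X :=
  Ideal.Quotient.mk_eq_mk_iff_sub_mem S T

theorem piZero_surjective : Function.Surjective (piZero (X := X)) := Ideal.Quotient.mk_surjective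

theorem piCalkin_surjective : Function.Surjective (piCalkin (X := X)) :=
  Ideal.Quotient.mk_surjective

theorem finiteRankIdeal_le_compactIdeal : finiteRankIdeal X ≤ compactIdeal X := by
  intro T hT
  have : FiniteDimensional ℂ T.range := hT
  have : LocallyCompactSpace T.range := .of_finiteDimensional_of_complete ℂ T.range
  have h : IsCompactOperator T.rangeRestrict :=
    isCompactOperator_of_locallyCompactSpace_dom T.rangeRestrict 
  exact h.clm_comp T.range.subtypeL

theorem piCalkin_eq_of_piZero_eq {S T : X →L[ℂ] X} (h : piZero S = piZero T) :
    piCalkin S = piCalkin T :=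
  piCalkin_eq_iff.2 (finiteRankIdeal_le_compactIdeal (piZero_eq_iff.1 h))

/-- A finite-rank operator is a regular element of `L(X)`. -/
theorem exists_mul_mul_eq_of_mem_finiteRankIdeal {F : X →L[ℂ] X} (hF : F ∈ finiteRankIdeal X) :
    ∃ W : X →L[ℂ] X, F * W * F = F := by
  have : FiniteDimensional ℂ F.range := hF
  obtain ⟨p, hp⟩ := Submodule.ClosedComplemented.of_finiteDimensional F.range
  obtain ⟨s, hs⟩ := F.toLinearMap.rangeRestrict.exists_rightInverse_of_surjective
    (LinearMap.range_rangeRestrict _)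
  refine ⟨s.toContinuousLinearMap ∘L p, ?_⟩
  ext x
  have h1 : p (F x) = ⟨F x, x, rfl⟩ := hp ⟨F x, x, rfl⟩
  have h2 := congr(($hs ⟨F x, x, rfl⟩ : X))
  simpa [h1] using h2

/-- McCoy's lemma. -/
theorem exists_mul_mul_eq_of_sub {A : Type*} [Ring A] {a b w : A}
    (h : (a - a * b * a) * w * (a - a * b * a) = a - a * b * a) : ∃ d, a * d * a = a := by
  -- As `a (1 - b a) = a - a b a = (1 - a b) a`, the correction term supplies exactly what `a b a`
  -- misses.
  refine ⟨b + (1 - b * a) * w * (1 - a * b), ?_⟩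
  linear_combination (norm := noncomm_ring) h

/-- `S D` is a bounded projection onto the range of `S`. -/
theorem closedComplemented_range_of_mul_mul_eq {S D : X →L[ℂ] X} (h : S * D * S = S) :
    IsClosed (S.range : Set X) ∧ S.range.ClosedComplemented := by
  have hc : S.range.ClosedComplemented := by
    refine ⟨(S * D).codRestrict S.range fun x => ⟨D x, rfl⟩, ?_⟩
    rintro ⟨_, x, rfl⟩
    exact Subtype.ext congr($h x)
  exact ⟨hc.isClosed, hc⟩

/-- On the kernel of `S` the finite-rank operator `B S - 1` is `-1`. -/
theorem finiteDimensional_ker_of_mul_sub_one_mem {S B : X →L[ℂ] X}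
    (h : B * S - 1 ∈ finiteRankIdeal X) : FiniteDimensional ℂ S.ker := by
  have : FiniteDimensional ℂ (B * S - 1).range := h
  refine Submodule.finiteDimensional_of_le (S₂ := (B * S - 1).range) ?_
  intro x hx
  refine ⟨-x, ?_⟩
  have hx' : S x = 0 := hx
  simp [hx']

/-- An operator with a left inverse modulo the finite-rank operators is left semi-Fredholm. -/
theorem isLeftSemiFredholm_of_mul_sub_one_mem {S B : X →L[ℂ] X}
    (h : B * S - 1 ∈ finiteRankIdeal X) : IsLeftSemiFredholm S := by
  have hmem : S - S * B * S ∈ finiteRankIdeal X := by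
    have : S - S * B * S = -S * (B * S - 1) := by noncomm_ring
    rw [this]
    exact Ideal.mul_mem_left _ _ h
  obtain ⟨W, hW⟩ := exists_mul_mul_eq_of_mem_finiteRankIdeal hmem
  obtain ⟨D, hD⟩ := exists_mul_mul_eq_of_sub hW
  obtain ⟨h1, h2⟩ := closedComplemented_range_of_mul_mul_eq hD
  exact ⟨⟨h1, finiteDimensional_ker_of_mul_sub_one_mem h⟩, h2⟩

/-- A left semi-Fredholm operator has a left inverse modulo the finite-rank operators. -/
theorem IsLeftSemiFredholm.exists_mul_sub_one_mem [CompleteSpace X] {S : X →L[ℂ] X}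
    (h : IsLeftSemiFredholm S) : ∃ B : X →L[ℂ] X, B * S - 1 ∈ finiteRankIdeal X := by
  obtain ⟨⟨hcl, hker⟩, hcc⟩ := h
  obtain ⟨M, hM⟩ := (Submodule.ClosedComplemented.of_finiteDimensional S.ker).exists_isTopCompl
  have hMcl : IsClosed (M : Set X) := hM.symm.closedComplemented.isClosed
  have : CompleteSpace M := hMcl.completeSpace_coe
  have hMS : ∀ x, ∃ m ∈ M, ∃ k ∈ S.ker, m + k = x := fun x => by
    have : x ∈ M ⊔ S.ker := by rw [hM.symm.isCompl.sup_eq_top]; trivial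
    exact Submodule.mem_sup.1 this
  have hrange : (S.domRestrict M).range = S.range := by
    refine le_antisymm (S.range_domRestrict_le_range M) ?_
    rintro _ ⟨x, rfl⟩
    obtain ⟨m, hm, k, hk, rfl⟩ := hMS x
    refine ⟨⟨m, hm⟩, ?_⟩
    have hk' : S k = 0 := hk
    simp [hk']
  have hinj : Function.Injective (S.domRestrict M) := by
    rw [injective_iff_map_eq_zero]
    rintro ⟨m, hm⟩ h0
    have : m ∈ S.ker ⊓ M := ⟨h0, hm⟩
    rw [hM.isCompl.inf_eq_bot] at this
    exact Subtype.ext this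
  -- A bounded left inverse of `S` on the complement `M` of its kernel: `g S - 1` vanishes on `M`
  -- and is `-1` on the kernel.
  obtain ⟨g, hg⟩ :=
    ContinuousLinearMap.HasLeftInverse.of_injective_of_isClosed_range_of_closedComplement_range
    (f := S.domRestrict M) hinj
    (by rw [← ContinuousLinearMap.range_toLinearMap, ← LinearMap.coe_range, hrange]; exact hcl)
    (by rw [hrange]; exact hcc)
  refine ⟨M.subtypeL ∘L g, ?_⟩
  refine Submodule.finiteDimensional_of_le (S₂ := S.ker) ?_
  rintro _ ⟨x, rfl⟩
  obtain ⟨m, hm, k, hk, rfl⟩ := hMS x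
  have hk' : S k = 0 := hk
  have hgm : g (S m) = ⟨m, hm⟩ := hg ⟨m, hm⟩
  have : (M.subtypeL ∘L g * S - 1) (m + k) = -k := by
    simp [hk', hgm]
  show (M.subtypeL ∘L g * S - 1) (m + k) ∈ S.ker
  rw [this]
  exact Submodule.neg_mem _ hk

/-! ### Fredholm operators and Atkinson's theorem -/

theorem isUnit_iff_exists_mul_eq_one {A : Type*} [Monoid A] {a : A} :
    IsUnit a ↔ ∃ b, b * a = 1 ∧ a * b = 1 := by
  constructor
  · rintro ⟨u, rfl⟩
    exact ⟨↑u⁻¹, u.inv_mul, u.mul_inv⟩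
  · rintro ⟨b, h1, h2⟩
    exact ⟨⟨a, b, h2, h1⟩, rfl⟩

theorem mul_sub_one_mem_finiteRankIdeal_iff {S T : X →L[ℂ] X} :
    S * T - 1 ∈ finiteRankIdeal X ↔ piZero S * piZero T = 1 := by
  rw [← map_mul, ← map_one piZero, piZero_eq_iff]

open scoped LinearMap.FiniteRangeSetoid in
theorem isLeftQuasiInverse_iff {S T : X →L[ℂ] X} :
    S.toLinearMap.IsLeftQuasiInverse T.toLinearMap ↔ piZero S * piZero T = 1 := by
  rw [← mul_sub_one_mem_finiteRankIdeal_iff, LinearMap.IsLeftQuasiInverse,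
    LinearMap.FiniteRangeSetoid.equiv_iff_hasFiniteRange, LinearMap.hasFiniteRange_iff_range,
    Submodule.fg_iff_finiteDimensional]
  rfl

theorem isFredholm_iff_isUnit_piZero {U : X →L[ℂ] X} : U.IsFredholm ↔ IsUnit (piZero U) := by
  rw [ContinuousLinearMap.isFredholm_iff_exists_isQuasiInverse, isUnit_iff_exists_mul_eq_one]
  constructor
  · rintro ⟨v, h1, h2⟩
    exact ⟨piZero v, isLeftQuasiInverse_iff.1 h1, isLeftQuasiInverse_iff.1 h2.isLeftQuasiInverse⟩
  · rintro ⟨b, h1, h2⟩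
    obtain ⟨v, rfl⟩ := piZero_surjective b
    exact ⟨v, isLeftQuasiInverse_iff.2 h1, (isLeftQuasiInverse_iff.2 h2).isRightQuasiInverse⟩

/-- Closedness of the range is not assumed: with `M` a complement of the kernel and `V` an algebraic
one of the range, `(m, v) ↦ S m + v` is a bounded bijection `M × V → X`, so its inverse is bounded
by the open mapping theorem. -/
theorem isUnit_piZero_of_finiteDimensional_ker_of_finiteDimensional_coker
    [CompleteSpace X] {S : X →L[ℂ] X}
    [FiniteDimensional ℂ S.ker] [FiniteDimensional ℂ (X ⧸ S.range)] : IsUnit (piZero S) := by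
  obtain ⟨M, hM⟩ := (Submodule.ClosedComplemented.of_finiteDimensional S.ker).exists_isTopCompl
  have hMcl : IsClosed (M : Set X) := hM.symm.closedComplemented.isClosed
  have : CompleteSpace M := hMcl.completeSpace_coe
  obtain ⟨V, hV⟩ := S.range.exists_isCompl
  have hVfin : FiniteDimensional ℂ V := (S.range.quotientEquivOfIsCompl V hV).finiteDimensional
  have : CompleteSpace V := FiniteDimensional.complete ℂ V
  have hMS : ∀ x, ∃ m ∈ M, ∃ k ∈ S.ker, m + k = x := fun x => by
    have : x ∈ M ⊔ S.ker := by rw [hM.symm.isCompl.sup_eq_top]; trivial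
    exact Submodule.mem_sup.1 this
  let E : (M × V) →L[ℂ] X := (S ∘L M.subtypeL).coprod V.subtypeL
  have hE : ∀ m v, E (m, v) = S m + v := fun m v => by simp [E]
  have hker : E.ker = ⊥ := by
    refine LinearMap.ker_eq_bot'.2 ?_
    rintro ⟨m, v⟩ h
    have h' : S m + v = 0 := (hE m v).symm.trans h
    have hv : (v : X) ∈ S.range ⊓ V :=
      ⟨⟨-m, by simpa using neg_eq_of_add_eq_zero_right h'⟩, v.2⟩
    rw [hV.inf_eq_bot] at hv
    have hv0 : (v : X) = 0 := hv
    have hm : (m : X) ∈ S.ker ⊓ M := ⟨by simpa [hv0] using h', m.2⟩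
    rw [hM.isCompl.inf_eq_bot] at hm
    exact Prod.ext (Subtype.ext hm) (Subtype.ext hv0)
  have hrange : E.range = ⊤ := by
    refine eq_top_iff.2 fun x _ => ?_
    have : x ∈ S.range ⊔ V := by rw [hV.sup_eq_top]; trivial
    obtain ⟨_, ⟨y, rfl⟩, v, hv, rfl⟩ := Submodule.mem_sup.1 this
    obtain ⟨m, hm, k, hk, rfl⟩ := hMS y
    have hk' : S k = 0 := hk
    exact ⟨(⟨m, hm⟩, ⟨v, hv⟩), by simp [E, hk']⟩
  let e := ContinuousLinearEquiv.ofBijective E hker hrange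
  have he : ∀ p, e p = E p := fun p => rfl
  let B : X →L[ℂ] X :=
    M.subtypeL ∘L (ContinuousLinearMap.fst ℂ M V) ∘L e.symm.toContinuousLinearMap
  have hB : ∀ p : M × V, B (E p) = p.1 := fun p => by
    rw [← he]; simp [B]
  refine isUnit_iff_exists_mul_eq_one.2 ⟨piZero B, ?_, ?_⟩
  · rw [← mul_sub_one_mem_finiteRankIdeal_iff]
    refine Submodule.finiteDimensional_of_le (S₂ := S.ker) ?_
    rintro _ ⟨x, rfl⟩
    obtain ⟨m, hm, k, hk, rfl⟩ := hMS x
    have hk' : S k = 0 := hk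
    have h1 : B (S m) = m := by
      have := hB (⟨m, hm⟩, 0)
      rwa [hE, ZeroMemClass.coe_zero, add_zero] at this
    have h2 : (B * S - 1) (m + k) = -k := by simp [hk', h1]
    exact (congrArg (· ∈ S.ker) h2).mpr (Submodule.neg_mem _ hk)
  · rw [← mul_sub_one_mem_finiteRankIdeal_iff]
    refine Submodule.finiteDimensional_of_le (S₂ := V) ?_
    rintro _ ⟨x, rfl⟩
    obtain ⟨⟨m, v⟩, rfl⟩ : ∃ p, E p = x := LinearMap.range_eq_top.1 hrange x
    have h2 : (S * B - 1) (E (m, v)) = -v := by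
      change S (B (E (m, v))) - E (m, v) = -v
      rw [hB, hE]
      abel
    exact (congrArg (· ∈ V) h2).mpr (Submodule.neg_mem _ v.2)

/-- `K` restricts to the identity of this kernel, which is therefore compact. -/
theorem finiteDimensional_ker_one_sub {K : X →L[ℂ] X} (hK : IsCompactOperator K) :
    FiniteDimensional ℂ (1 - K).ker := by
  have hfix : ∀ x ∈ (1 - K).ker, K x = x := fun x hx => by
    have hx' : x - K x = 0 := hx
    exact (sub_eq_zero.1 hx').symm
  have hmaps : ∀ x ∈ (1 - K).ker, K.toLinearMap x ∈ (1 - K).ker := fun x hx => by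
    rw [ContinuousLinearMap.coe_coe, hfix x hx]; exact hx
  have h := IsCompactOperator.restrict (f := K.toLinearMap) hK hmaps (1 - K).isClosed_ker
  refine FiniteDimensional.of_isCompactOperator_id (𝕜 := ℂ) ?_
  have hid : (id : (1 - K).ker → (1 - K).ker) = K.toLinearMap.restrict hmaps :=
    funext fun x => Subtype.ext (hfix x x.2).symm
  rwa [hid]

/-- Riesz: compact perturbations of the identity are Fredholm. -/
theorem isUnit_piZero_one_sub [CompleteSpace X] {K : X →L[ℂ] X} (hK : IsCompactOperator K) :
    IsUnit (piZero (1 - K)) := by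
  have hN := finiteDimensional_ker_one_sub hK
  set S := 1 - K with hS
  -- If the kernel embeds in the cokernel, lifting the embedding gives a finite-rank `F` with `S - F
  -- = 1 - (K + F)` injective, so invertible by the Fredholm alternative. Otherwise the cokernel is
  -- finite-dimensional.
  by_cases hrank : Module.rank ℂ S.ker ≤ Module.rank ℂ (X ⧸ S.range)
  · obtain ⟨φ, hφ⟩ := rank_le_iff_exists_linearMap.1 hrank
    obtain ⟨ψ, hψ⟩ := Module.projective_lifting_property S.range.mkQ φ
      (Submodule.mkQ_surjective _)
    obtain ⟨p, hp⟩ := Submodule.ClosedComplemented.of_finiteDimensional S.ker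
    let F : X →L[ℂ] X := ψ.toContinuousLinearMap ∘L p
    have hF : F ∈ finiteRankIdeal X := by
      refine Submodule.finiteDimensional_of_le (S₂ := ψ.range) ?_
      rintro _ ⟨x, rfl⟩
      exact ⟨p x, rfl⟩
    have hKF : IsCompactOperator (K + F) :=
      (compactIdeal X).add_mem hK (finiteRankIdeal_le_compactIdeal hF)
    have hinj : ∀ x, S x = F x → x = 0 := fun x hx => by
      have h1 : φ (p x) = 0 := by
        rw [← hψ]
        refine (Submodule.Quotient.mk_eq_zero _).2 ?_
        exact ⟨x, hx⟩
      have h2 : p x = 0 := (map_eq_zero_iff φ hφ).1 h1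
      have h3 : S x = 0 := by rw [hx]; simp [F, h2]
      have h4 := hp ⟨x, h3⟩
      rw [h2] at h4
      exact congr(($h4 : X)).symm
    have hunit : IsUnit (S - F) := by
      rcases IsCompactOperator.hasEigenvalue_or_mem_resolventSet hKF one_ne_zero with h | h
      · obtain ⟨x, hx⟩ := h.exists_hasEigenvector
        have h1 : K x + F x = x := by simpa using hx.apply_eq_smul
        refine absurd (hinj x ?_) hx.2
        rw [hS]
        simpa [sub_eq_iff_eq_add, add_comm] using h1.symm
      · rw [spectrum.mem_resolventSet_iff] at h
        simpa [hS, sub_sub] using h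
    have : piZero S = piZero (S - F) := by
      rw [piZero_eq_iff]; simpa using hF
    rw [this]
    exact hunit.map piZero
  · have hQ : FiniteDimensional ℂ (X ⧸ S.range) :=
      Module.rank_lt_aleph0_iff.1 ((not_le.1 hrank).trans (Module.rank_lt_aleph0 ℂ S.ker))
    exact isUnit_piZero_of_finiteDimensional_ker_of_finiteDimensional_coker

/-- Atkinson's theorem. -/
theorem isUnit_piZero_iff_isUnit_piCalkin [CompleteSpace X] {U : X →L[ℂ] X} :
    IsUnit (piZero U) ↔ IsUnit (piCalkin U) := by
  constructor
  · intro h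
    obtain ⟨b, h1, h2⟩ := isUnit_iff_exists_mul_eq_one.1 h
    obtain ⟨B, rfl⟩ := piZero_surjective b
    rw [← map_mul, ← map_one piZero] at h1 h2
    refine isUnit_iff_exists_mul_eq_one.2 ⟨piCalkin B, ?_, ?_⟩
    · simpa using piCalkin_eq_of_piZero_eq h1
    · simpa using piCalkin_eq_of_piZero_eq h2
  · intro h
    obtain ⟨b, h1, h2⟩ := isUnit_iff_exists_mul_eq_one.1 h
    obtain ⟨B, rfl⟩ := piCalkin_surjective b
    -- Applied to `B U` and `U B`, this yields a left and a right inverse of `π(U)`, which must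
    -- agree.
    have key : ∀ V : X →L[ℂ] X, piCalkin V = 1 → IsUnit (piZero V) := fun V hV => by
      rw [← map_one piCalkin, eq_comm, piCalkin_eq_iff] at hV
      simpa using isUnit_piZero_one_sub hV
    obtain ⟨c, hc, -⟩ := isUnit_iff_exists_mul_eq_one.1 (key (B * U) (by rw [map_mul, h1]))
    obtain ⟨d, -, hd⟩ := isUnit_iff_exists_mul_eq_one.1 (key (U * B) (by rw [map_mul, h2]))
    rw [map_mul] at hc hd
    rw [← mul_assoc] at hc
    rw [mul_assoc] at hd
    refine isUnit_iff_exists_mul_eq_one.2 ⟨c * piZero B, hc, ?_⟩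
    rw [left_inv_eq_right_inv hc hd, hd]

/-! ### Compressions to the range of an idempotent and extensions by zero -/

section Compression

/-- The extension by `0` of an operator on the range of `P` along `P`. -/
def extension (P : X →L[ℂ] X) (A : P.range →L[ℂ] P.range) : X →L[ℂ] X :=
  P.range.subtypeL ∘L A ∘L P.rangeRestrict

@[simp]
theorem coe_compression_apply (P A : X →L[ℂ] X) (x : P.range) :
    (compression P A x : X) = P (A (P x)) := rfl

variable {P : X →L[ℂ] X}

theorem apply_coe_range (hP : P * P = P) (x : P.range) : P x = x := by
  obtain ⟨_, y, rfl⟩ := x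
  exact congr($hP y)

theorem compression_one (hP : P * P = P) : compression P 1 = 1 := by
  ext x
  simp [apply_coe_range hP]

theorem compression_mul_compression (hP : P * P = P) (A B : X →L[ℂ] X) :
    compression P A * compression P B = compression P (A * P * B) := by
  ext x
  exact congr(P (A $(congr($hP (B (P x))))))

theorem compression_mul_left (hP : P * P = P) (A : X →L[ℂ] X) :
    compression P (P * A) = compression P A := by
  ext x
  exact congr($hP (A (P x)))

theorem compression_mul_right (hP : P * P = P) (A : X →L[ℂ] X) :
    compression P (A * P) = compression P A := by
  ext x
  exact congr(P (A $(congr($hP x))))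

theorem compression_add (A B : X →L[ℂ] X) :
    compression P (A + B) = compression P A + compression P B := by
  ext x
  simp

theorem compression_sub (A B : X →L[ℂ] X) :
    compression P (A - B) = compression P A - compression P B := by
  ext x
  simp

theorem compression_smul (c : ℂ) (A : X →L[ℂ] X) :
    compression P (c • A) = c • compression P A := by
  ext x
  simp

theorem compression_mem_finiteRankIdeal {F : X →L[ℂ] X} (hF : F ∈ finiteRankIdeal X) :
    compression P F ∈ finiteRankIdeal P.range := by
  have : FiniteDimensional ℂ F.range := hF
  refine Submodule.finiteDimensional_of_le
    (S₂ := F.range.map P.rangeRestrict.toLinearMap) ?_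
  rintro _ ⟨x, rfl⟩
  exact ⟨F (P x), ⟨P x, rfl⟩, rfl⟩

theorem piZero_compression_congr {A B : X →L[ℂ] X} (h : piZero A = piZero B) :
    piZero (compression P A) = piZero (compression P B) := by
  rw [piZero_eq_iff] at h ⊢
  rw [← compression_sub]
  exact compression_mem_finiteRankIdeal h

/-- The inner `P` in `P B P A P` can be moved past `A` up to finite rank. -/
theorem piZero_compression_mul (hP : P * P = P) {A B : X →L[ℂ] X}
    (hA : Commute (piZero P) (piZero A)) :
    piZero (compression P B) * piZero (compression P A) = piZero (compression P (B * A)) := by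
  rw [← map_mul, compression_mul_compression hP, ← compression_mul_right hP (B * A)]
  apply piZero_compression_congr
  simp only [map_mul, mul_assoc, hA.eq]

theorem piZero_compression_mul' (hP : P * P = P) {A B : X →L[ℂ] X}
    (hA : Commute (piZero P) (piZero A)) :
    piZero (compression P A) * piZero (compression P B) = piZero (compression P (A * B)) := by
  rw [← map_mul, compression_mul_compression hP, ← compression_mul_left hP (A * B)]
  apply piZero_compression_congr
  simp only [map_mul, ← mul_assoc, hA.eq]

theorem piZero_compression_mul_eq_one (hP : P * P = P) {A B : X →L[ℂ] X}
    (hA : Commute (piZero P) (piZero A)) (h : piZero B * piZero A = 1) :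
    piZero (compression P B) * piZero (compression P A) = 1 := by
  rw [piZero_compression_mul hP hA, ← map_one piZero, ← compression_one hP]
  apply piZero_compression_congr
  simpa using h

theorem piZero_compression_mul_eq_one' (hP : P * P = P) {A B : X →L[ℂ] X}
    (hA : Commute (piZero P) (piZero A)) (h : piZero A * piZero B = 1) :
    piZero (compression P A) * piZero (compression P B) = 1 := by
  rw [piZero_compression_mul' hP hA, ← map_one piZero, ← compression_one hP]
  apply piZero_compression_congr
  simpa using h

theorem extension_mul (hP : P * P = P) (A B : P.range →L[ℂ] P.range) :
    extension P A * extension P B = extension P (A * B) := by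
  ext x
  have : P.rangeRestrict (B (P.rangeRestrict x)) = B (P.rangeRestrict x) :=
    Subtype.ext (apply_coe_range hP _)
  exact congr((A $this : X))

theorem extension_one : extension P 1 = P := rfl

theorem extension_sub (A B : P.range →L[ℂ] P.range) :
    extension P (A - B) = extension P A - extension P B := by
  ext x
  simp [extension]

theorem extension_smul (c : ℂ) (A : P.range →L[ℂ] P.range) :
    extension P (c • A) = c • extension P A := by
  ext x
  simp [extension]

theorem extension_compression (hP : P * P = P) (A : X →L[ℂ] X) :
    extension P (compression P A) = P * A * P := by
  ext x
  exact congr(P (A $(congr($hP x))))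

theorem mul_extension (hP : P * P = P) (A : P.range →L[ℂ] P.range) :
    P * extension P A = extension P A := by
  ext x
  exact apply_coe_range hP _

theorem extension_mul_self (hP : P * P = P) (A : P.range →L[ℂ] P.range) :
    extension P A * P = extension P A := by
  ext x
  have : P.rangeRestrict (P x) = P.rangeRestrict x := Subtype.ext congr($hP x)
  exact congr((A $this : X))

theorem piZero_extension_congr {A B : P.range →L[ℂ] P.range} (h : piZero A = piZero B) :
    piZero (extension P A) = piZero (extension P B) := by
  rw [piZero_eq_iff] at h ⊢
  have : FiniteDimensional ℂ (A - B).range := h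
  rw [← extension_sub]
  refine Submodule.finiteDimensional_of_le (S₂ := (A - B).range.map P.range.subtype) ?_
  rintro _ ⟨x, rfl⟩
  exact ⟨(A - B) (P.rangeRestrict x), ⟨_, rfl⟩, rfl⟩

theorem piZero_extension_mul_eq (hP : P * P = P) {A B : P.range →L[ℂ] P.range}
    (h : piZero A * piZero B = 1) : piZero (extension P A) * piZero (extension P B) = piZero P := by
  rw [← map_mul, extension_mul hP]
  rw [← map_mul, ← map_one piZero] at h
  rw [piZero_extension_congr h, extension_one]

theorem isClosed_range_of_mul_self (hP : P * P = P) : IsClosed (P.range : Set X) :=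
  (closedComplemented_range_of_mul_mul_eq (S := P) (D := 1) (by rwa [mul_one])).1

end Compression

/-! ### The diagonal blocks of `T` modulo finite rank -/

section Transfer

variable {P T : X →L[ℂ] X}

theorem one_sub_mul_one_sub (hP : P * P = P) : (1 - P) * (1 - P) = 1 - P := by
  linear_combination (norm := noncomm_ring) hP

theorem commute_piZero_one_sub {A : X →L[ℂ] X} (h : Commute (piZero P) (piZero A)) :
    Commute (piZero (1 - P)) (piZero A) := by
  rw [map_sub, map_one]
  exact (Commute.one_left _).sub_left h

theorem piZero_mul_mul_self (hP : P * P = P) (hT : Commute (piZero P) (piZero T)) :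
    piZero (P * T * P) = piZero (P * T) := by
  rw [map_mul, map_mul, mul_assoc, ← hT.eq, ← mul_assoc, ← map_mul, hP]

theorem commute_piZero_sub_smul (hT : Commute (piZero P) (piZero T)) (μ : ℂ) :
    Commute (piZero P) (piZero (T - μ • (1 : X →L[ℂ] X))) := by
  rw [map_sub]
  refine hT.sub_right ?_
  rw [commute_iff_eq, ← map_mul, ← map_mul, mul_smul_comm, smul_mul_assoc, one_mul, mul_one]

theorem sub_smul_mul_sub_smul {A : Type*} [Ring A] [Algebra ℂ A] {s e q : A} {μ ν : ℂ}
    (hμν : μ * ν = 1) (hsq : s * q = 0) (hqe : q * e = 0) (hq : q * q = q) :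
    (s - μ • q) * (e - ν • q) = s * e + q := by
  rw [sub_mul, mul_sub, mul_sub, mul_smul_comm, smul_mul_assoc, smul_mul_smul_comm, hsq, hqe, hq,
    hμν]
  simp

/-- Modulo finite rank, `P T - μ` is `T₁ - μ` on the range of `P` and the invertible scalar `-μ` on
its kernel. -/
theorem isRiesz_compression_iff (hP : P * P = P) (hT : Commute (piZero P) (piZero T)) :
    IsRiesz (compression P T) ↔
      ∀ μ : ℂ, μ ≠ 0 → IsUnit (piZero (P * T - μ • (1 : X →L[ℂ] X))) := by
  refine forall₂_congr fun μ hμ => ?_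
  rw [isFredholm_iff_isUnit_piZero, isUnit_iff_exists_mul_eq_one, isUnit_iff_exists_mul_eq_one]
  constructor
  · rintro ⟨s, h1, h2⟩
    obtain ⟨S, rfl⟩ := piZero_surjective s
    have e1 := piZero_extension_mul_eq hP h1
    have e2 := piZero_extension_mul_eq hP h2
    have hE : piZero (P * T - μ • (1 : X →L[ℂ] X)) =
        piZero (extension P (compression P T - μ • 1)) - piZero (μ • (1 - P)) := by
      rw [map_sub, ← piZero_mul_mul_self hP hT, ← map_sub, ← map_sub, extension_sub,
        extension_smul, extension_one, extension_compression hP]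
      congr 1
      module
    set E := extension P (compression P T - μ • 1) with hEdef
    have z1 : extension P S * (1 - P) = 0 := by
      rw [mul_sub, mul_one, extension_mul_self hP, sub_self]
    have z2 : (1 - P) * extension P S = 0 := by
      rw [sub_mul, one_mul, mul_extension hP, sub_self]
    have z3 : E * (1 - P) = 0 := by rw [mul_sub, mul_one, extension_mul_self hP, sub_self]
    have z4 : (1 - P) * E = 0 := by rw [sub_mul, one_mul, mul_extension hP, sub_self]
    have hQ := one_sub_mul_one_sub hP
    have r1 : (extension P S - μ⁻¹ • (1 - P)) * (E - μ • (1 - P)) =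
        extension P S * E + (1 - P) := by
      exact sub_smul_mul_sub_smul (inv_mul_cancel₀ hμ) z1 z4 hQ
    have r2 : (E - μ • (1 - P)) * (extension P S - μ⁻¹ • (1 - P)) =
        E * extension P S + (1 - P) := by
      exact sub_smul_mul_sub_smul (mul_inv_cancel₀ hμ) z3 z2 hQ
    refine ⟨piZero (extension P S - μ⁻¹ • (1 - P)), ?_, ?_⟩
    · rw [hE, ← map_sub, ← map_mul, r1, map_add, map_mul, e1, ← map_add, add_sub_cancel, map_one]
    · rw [hE, ← map_sub, ← map_mul, r2, map_add, map_mul, e2, ← map_add, add_sub_cancel, map_one]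
  · rintro ⟨s, h1, h2⟩
    obtain ⟨S, rfl⟩ := piZero_surjective s
    have hc : Commute (piZero P) (piZero (P * T - μ • (1 : X →L[ℂ] X))) := by
      refine commute_piZero_sub_smul ?_ μ
      rw [map_mul]
      exact (Commute.refl _).mul_right hT
    have hcomp : compression P (P * T - μ • (1 : X →L[ℂ] X)) = compression P T - μ • 1 := by
      rw [compression_sub, compression_smul, compression_one hP, compression_mul_left hP]
    rw [← hcomp]
    exact ⟨piZero (compression P S), piZero_compression_mul_eq_one hP hc h1,
      piZero_compression_mul_eq_one' hP hc h2⟩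

theorem compression_one_sub_self (hP : P * P = P) : compression (1 - P) P = 0 := by
  rw [← compression_mul_right (one_sub_mul_one_sub hP), mul_sub, mul_one, hP, sub_self]
  exact ContinuousLinearMap.ext fun _ => Subtype.ext (map_zero (1 - P))

/-- `T + P` and `T` have the same compression to the kernel of `P`, so a left inverse of `π(T + P)`
compresses to one for `T₂`. -/
theorem isLeftSemiFredholm_compression_of_isLeftPInvertible (hP : P * P = P)
    (h : IsLeftPInvertible (piZero T) (piZero P)) :
    IsLeftSemiFredholm (compression (1 - P) T) := by
  obtain ⟨hc, b, -, hb⟩ := h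
  obtain ⟨B, rfl⟩ := piZero_surjective b
  have hTP : Commute (piZero P) (piZero (T + P)) := by
    rw [map_add]
    exact (show Commute (piZero P) (piZero T) from hc.symm).add_right (Commute.refl _)
  rw [← map_add] at hb
  have h1 := piZero_compression_mul_eq_one (one_sub_mul_one_sub hP)
    (commute_piZero_one_sub hTP) hb
  rw [compression_add, compression_one_sub_self hP, add_zero] at h1
  exact isLeftSemiFredholm_of_mul_sub_one_mem (mul_sub_one_mem_finiteRankIdeal_iff.2 h1)

theorem extension_mul_extension_of_mul_eq_zero {Q : X →L[ℂ] X} (hP : P * P = P) (hQ : Q * Q = Q)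
    (hPQ : P * Q = 0) (A : P.range →L[ℂ] P.range) (B : Q.range →L[ℂ] Q.range) :
    extension P A * extension Q B = 0 := by
  rw [← extension_mul_self hP, ← mul_extension hQ, mul_assoc, ← mul_assoc P, hPQ, zero_mul,
    mul_zero]

theorem isLeftPInvertible_of_isRiesz_of_isLeftSemiFredholm [CompleteSpace X] (hP : P * P = P)
    (hT : Commute (piZero P) (piZero T)) (h1 : IsRiesz (compression P T))
    (h2 : IsLeftSemiFredholm (compression (1 - P) T)) :
    IsLeftPInvertible (piZero T) (piZero P) := by
  have hQ := one_sub_mul_one_sub hP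
  have hPQ : P * (1 - P) = 0 := by rw [mul_sub, mul_one, hP, sub_self]
  have hQP : (1 - P) * P = 0 := by rw [sub_mul, one_mul, hP, sub_self]
  have : CompleteSpace (1 - P).range := (isClosed_range_of_mul_self hQ).completeSpace_coe
  -- `μ = -1`, because the block of `T + P` on the range of `P` is `T₁ + 1`.
  obtain ⟨s, hs, -⟩ := isUnit_iff_exists_mul_eq_one.1
    (isFredholm_iff_isUnit_piZero.1 (h1 (-1) (by simp)))
  obtain ⟨S, rfl⟩ := piZero_surjective s
  obtain ⟨B, hB⟩ := h2.exists_mul_sub_one_mem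
  have e1 := piZero_extension_mul_eq hP hs
  have e2 := piZero_extension_mul_eq hQ (mul_sub_one_mem_finiteRankIdeal_iff.1 hB)
  refine ⟨hT.symm, piZero (extension P S + extension (1 - P) B), ?_, ?_⟩
  · have c1 : extension (1 - P) B * P = 0 := by
      rw [← extension_mul_self hQ, mul_assoc, hQP, mul_zero]
    have c2 : P * extension (1 - P) B = 0 := by
      rw [← mul_extension hQ, ← mul_assoc, hPQ, zero_mul]
    change _ * _ = _ * _
    rw [← map_mul, ← map_mul, add_mul, mul_add, c1, c2, extension_mul_self hP, mul_extension hP]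
  · have hsum : piZero T + piZero P =
        piZero (extension P (compression P T - (-1 : ℂ) • 1)) +
          piZero (extension (1 - P) (compression (1 - P) T)) := by
      rw [extension_sub, extension_smul, extension_one, extension_compression hP,
        extension_compression hQ, map_sub, piZero_mul_mul_self hP hT,
        piZero_mul_mul_self hQ (commute_piZero_one_sub hT), neg_smul, one_smul, ← map_add,
        ← map_sub, ← map_add]
      congr 1
      noncomm_ring
    rw [hsum, map_add, add_mul, mul_add, mul_add, e1, e2, ← map_mul, ← map_mul,
      extension_mul_extension_of_mul_eq_zero hP hQ hPQ,
      extension_mul_extension_of_mul_eq_zero hQ hP hQP, map_zero, add_zero, zero_add, ← map_add,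
      add_sub_cancel, map_one]

end Transfer

/-! ### Associated idempotents in `C₀(X)` and `C(X)` -/

section Associated

variable {P T : X →L[ℂ] X}

theorem isClosed_compactIdeal [CompleteSpace X] : IsClosed (compactIdeal X : Set (X →L[ℂ] X)) :=
  isClosed_setOfPred_isCompactOperator

theorem smul_one_sub_eq {A : X →L[ℂ] X} {μ : ℂ} (hμ : μ ≠ 0) :
    A - μ • (1 : X →L[ℂ] X) = (-μ • (1 : X →L[ℂ] X)) * (1 - (μ⁻¹ • (1 : X →L[ℂ] X)) * A) := by
  rw [smul_mul_assoc, smul_mul_assoc, one_mul, one_mul, smul_sub, smul_smul, neg_mul,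
    mul_inv_cancel₀ hμ]
  module

theorem isUnit_smul_one {μ : ℂ} (hμ : μ ≠ 0) : IsUnit (μ • (1 : X →L[ℂ] X)) := by
  rw [← Algebra.algebraMap_eq_smul_one]
  exact (IsUnit.mk0 μ hμ).map (algebraMap ℂ (X →L[ℂ] X))

/-- Quasinilpotence is tested on the scalar `μ⁻¹`, which commutes with everything: `A - μ = -μ (1 -
μ⁻¹ A)`. -/
theorem isUnit_of_isQuasinilpotent {B : Type*} [Ring B] (f : (X →L[ℂ] X) →+* B)
    {A : X →L[ℂ] X} (h : IsQuasinilpotent (f A)) {μ : ℂ} (hμ : μ ≠ 0) :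
    IsUnit (f (A - μ • (1 : X →L[ℂ] X))) := by
  rw [smul_one_sub_eq hμ, map_mul, map_sub, map_one, map_mul]
  refine ((isUnit_smul_one (neg_ne_zero.2 hμ)).map f).mul (h _ ?_)
  change _ * _ = _ * _
  rw [← map_mul, ← map_mul, smul_mul_assoc, mul_smul_comm, one_mul, mul_one]

theorem isQuasinilpotent_piCalkin_iff [CompleteSpace X] {A : X →L[ℂ] X} :
    IsQuasinilpotent (piCalkin A) ↔
      ∀ μ : ℂ, μ ≠ 0 → IsUnit (piZero (A - μ • (1 : X →L[ℂ] X))) := by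
  constructor
  · intro h μ hμ
    exact isUnit_piZero_iff_isUnit_piCalkin.2 (isUnit_of_isQuasinilpotent piCalkin h hμ)
  · intro h
    exact isQuasinilpotent_quotient_of_forall_isUnit_sub _ isClosed_compactIdeal fun μ hμ =>
      isUnit_piZero_iff_isUnit_piCalkin.1 (h μ hμ)

theorem isQuasinilpotent_piZero_iff [CompleteSpace X] {A : X →L[ℂ] X} :
    IsQuasinilpotent (piZero A) ↔
      ∀ μ : ℂ, μ ≠ 0 → IsUnit (piZero (A - μ • (1 : X →L[ℂ] X))) := by
  constructor
  · intro h μ hμ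
    exact isUnit_of_isQuasinilpotent piZero h hμ
  · intro h x hx
    obtain ⟨Z, rfl⟩ := piZero_surjective x
    have hx' : piZero (Z * A) = piZero (A * Z) := by
      rw [map_mul, map_mul]; exact hx
    -- Commuting modulo `F₀` implies commuting modulo `K`, so `1 - Z A` is invertible in `C(X)`, and
    -- then in `C₀(X)` by Atkinson.
    have hZ : piCalkin Z ∈ commutant (piCalkin A) := by
      have := piCalkin_eq_of_piZero_eq hx'
      rwa [map_mul, map_mul] at this
    have h1 := isQuasinilpotent_piCalkin_iff.2 h _ hZ
    rw [← map_one piCalkin, ← map_mul, ← map_sub, ← isUnit_piZero_iff_isUnit_piCalkin] at h1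
    rwa [map_sub, map_one, map_mul] at h1

theorem IsLeftPInvertible.piCalkin (h : IsLeftPInvertible (piZero T) (piZero P)) :
    IsLeftPInvertible (piCalkin T) (piCalkin P) := by
  obtain ⟨h0, b, hb, h1⟩ := h
  obtain ⟨B, rfl⟩ := piZero_surjective b
  change _ * _ = _ * _ at hb
  rw [← map_mul, ← map_mul] at h0 hb
  rw [← map_add, ← map_mul, ← map_one piZero] at h1
  refine ⟨?_, FredholmType.piCalkin B, ?_, ?_⟩
  · simpa using piCalkin_eq_of_piZero_eq h0
  · change _ * _ = _ * _
    simpa using piCalkin_eq_of_piZero_eq hb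
  · simpa using piCalkin_eq_of_piZero_eq h1

theorem isLeftPInvertible_of_mul_eq_one {A : Type*} [Ring A] {a b p : A} (hp : p * p = p)
    (hap : a * p = p * a) (h : b * (a + p) = 1) : IsLeftPInvertible a p := by
  have hc : (a + p) * p = p * (a + p) := by rw [add_mul, mul_add, hap]
  have hq : (1 - p) * (1 - p) = 1 - p := by
    linear_combination (norm := noncomm_ring) hp
  have hcq : (a + p) * (1 - p) = (1 - p) * (a + p) := by
    rw [mul_sub, sub_mul, hc, one_mul, mul_one]
  -- The diagonal part of `b` commutes with `p`, and is still a left inverse because `a + p` is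
  -- itself diagonal.
  refine ⟨hap, p * b * p + (1 - p) * b * (1 - p), ?_, ?_⟩
  · change _ * _ = _ * _
    have h1 : (p * b * p + (1 - p) * b * (1 - p)) * p = p * b * p := by
      linear_combination (norm := noncomm_ring) (p * b - (1 - p) * b) * hp
    have h2 : p * (p * b * p + (1 - p) * b * (1 - p)) = p * b * p := by
      linear_combination (norm := noncomm_ring) hp * (b * p - b * (1 - p))
    rw [h1, h2]
  · rw [add_mul, mul_assoc _ p, ← hc, mul_assoc _ (1 - p), ← hcq]
    calc p * b * ((a + p) * p) + (1 - p) * b * ((a + p) * (1 - p))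
        = p * (b * (a + p)) * p + (1 - p) * (b * (a + p)) * (1 - p) := by noncomm_ring
      _ = 1 := by rw [h, mul_one, mul_one, hp, hq, add_sub_cancel]

theorem isLeftPInvertible_piZero_of_piCalkin [CompleteSpace X] (hP : P * P = P)
    (hT : Commute (piZero P) (piZero T))
    (h : IsLeftPInvertible (piCalkin T) (piCalkin P)) :
    IsLeftPInvertible (piZero T) (piZero P) := by
  obtain ⟨-, b, -, hb⟩ := h
  obtain ⟨B, rfl⟩ := piCalkin_surjective b
  -- `B (T + P)` is `1` modulo compacts, so Atkinson makes it a unit in `C₀(X)`; its inverse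
  -- corrects `B` to a left inverse there.
  have hu : IsUnit (piZero (B * (T + P))) := by
    rw [isUnit_piZero_iff_isUnit_piCalkin, map_mul, map_add, hb]
    exact isUnit_one
  obtain ⟨c, hc, -⟩ := isUnit_iff_exists_mul_eq_one.1 hu
  rw [map_mul, map_add, ← mul_assoc] at hc
  exact isLeftPInvertible_of_mul_eq_one (by rw [← map_mul, hP]) hT.symm hc

theorem commute_of_mem_bicommutant {A : Type*} [Ring A] {a x : A} (h : x ∈ bicommutant a) :
    Commute x a := h a rfl

theorem IsLeftAssociatedZero.isLeftAssociatedCalkin [CompleteSpace X]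
    (h : IsLeftAssociatedZero T P) :
    IsLeftAssociatedCalkin T P where
  idem := h.idem
  mem_commutant := (h.leftInvertible.piCalkin).1.symm
  quasinilpotent := by
    have := h.quasinilpotent
    rw [← map_mul] at this ⊢
    exact isQuasinilpotent_piCalkin_iff.2 (isQuasinilpotent_piZero_iff.1 this)
  leftInvertible := h.leftInvertible.piCalkin

theorem IsLeftAssociatedCalkin.isLeftAssociatedZero [CompleteSpace X]
    (h : IsLeftAssociatedCalkin T P) (hP : piZero P ∈ bicommutant (piZero T)) :
    IsLeftAssociatedZero T P where
  idem := h.idem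
  mem_bicommutant := hP
  quasinilpotent := by
    have := h.quasinilpotent
    rw [← map_mul] at this ⊢
    exact isQuasinilpotent_piZero_iff.2 (isQuasinilpotent_piCalkin_iff.1 this)
  leftInvertible := isLeftPInvertible_piZero_of_piCalkin h.idem (commute_of_mem_bicommutant hP)
    h.leftInvertible

theorem isLeftAssociatedZero_iff [CompleteSpace X] : IsLeftAssociatedZero T P ↔
    P * P = P ∧ piZero P ∈ bicommutant (piZero T) ∧ IsRiesz (compression P T) ∧
      IsLeftSemiFredholm (compression (1 - P) T) := by
  constructor
  · intro h
    have hT := commute_of_mem_bicommutant h.mem_bicommutant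
    refine ⟨h.idem, h.mem_bicommutant, ?_,
      isLeftSemiFredholm_compression_of_isLeftPInvertible h.idem h.leftInvertible⟩
    rw [isRiesz_compression_iff h.idem hT, ← isQuasinilpotent_piZero_iff, map_mul]
    exact h.quasinilpotent
  · rintro ⟨hP, hb, h1, h2⟩
    have hT := commute_of_mem_bicommutant hb
    refine ⟨hP, hb, ?_, isLeftPInvertible_of_isRiesz_of_isLeftSemiFredholm hP hT h1 h2⟩
    rwa [← map_mul, isQuasinilpotent_piZero_iff, ← isRiesz_compression_iff hP hT]

theorem isRieszLeftSemiFredholm_of_compression (hP : P * P = P)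
    (h1 : IsRiesz (compression P T)) (h2 : IsLeftSemiFredholm (compression (1 - P) T)) :
    IsRieszLeftSemiFredholm (P * T * P + (1 - P) * T * (1 - P)) := by
  have hQ := one_sub_mul_one_sub hP
  have hPQ : ∀ x, P ((1 - P) x) = 0 := fun x => by
    have : P * (1 - P) = 0 := by rw [mul_sub, mul_one, hP, sub_self]
    exact congr($this x)
  have hQP : ∀ x, (1 - P) (P x) = 0 := fun x => by
    have : (1 - P) * P = 0 := by rw [sub_mul, one_mul, hP, sub_self]
    exact congr($this x)
  set R := P * T * P + (1 - P) * T * (1 - P) with hR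
  have hRx : ∀ x, R x = P (T (P x)) + (1 - P) (T ((1 - P) x)) := fun x => rfl
  have hM : ∀ x ∈ P.range, R x = P (T (P x)) := by
    rintro _ ⟨y, rfl⟩
    change R (P y) = _
    rw [hRx, hQP, map_zero, map_zero, add_zero]
    rfl
  have hN : ∀ x ∈ (1 - P).range, R x = (1 - P) (T ((1 - P) x)) := by
    rintro _ ⟨y, rfl⟩
    change R ((1 - P) y) = _
    rw [hRx, hPQ, map_zero, map_zero, zero_add]
    rfl
  refine ⟨P.range, (1 - P).range, fun x hx => hM x hx ▸ ⟨_, rfl⟩, fun x hx => hN x hx ▸ ⟨_, rfl⟩,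
    isClosed_range_of_mul_self hP, isClosed_range_of_mul_self hQ, ⟨?_, ?_⟩, ?_, ?_⟩
  · rw [Submodule.disjoint_def]
    rintro _ ⟨y, rfl⟩ ⟨z, hz⟩
    have h3 : P (P y) = P y := congr($hP y)
    have h4 : (1 - P) z = P y := hz
    change P y = 0
    rw [← h3, ← h4, hPQ]
  · rw [codisjoint_iff, eq_top_iff]
    intro x _
    exact Submodule.mem_sup.2 ⟨P x, ⟨x, rfl⟩, (1 - P) x, ⟨x, rfl⟩, by simp⟩
  · convert h1 using 1
    ext x
    exact hM x x.2
  · convert h2 using 1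
    ext x
    exact hN x x.2

/-- The difference is the off-diagonal part of `T`, which vanishes in `C₀(X)` by commutation. -/
theorem isFiniteRank_sub_of_commute (hP : P * P = P) (hT : Commute (piZero P) (piZero T)) :
    IsFiniteRank (T - (P * T * P + (1 - P) * T * (1 - P))) := by
  refine piZero_eq_iff.1 ?_
  rw [map_add, piZero_mul_mul_self hP hT,
    piZero_mul_mul_self (one_sub_mul_one_sub hP) (commute_piZero_one_sub hT), ← map_add]
  congr 1
  noncomm_ring

end Associated
end FredholmType

theorem theorem3p6 {X : Type*} [NormedAddCommGroup X] [NormedSpace ℂ X] [CompleteSpace X]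
    (T : X →L[ℂ] X) :
    List.TFAE
      [ FredholmType.IsLeftGenDrazinZero T,
        FredholmType.IsLeftPseudoSemiBFredholm T ∧
          ∃ P : X →L[ℂ] X, FredholmType.IsLeftAssociatedCalkin T P ∧
            FredholmType.piZero P ∈ FredholmType.bicommutant (FredholmType.piZero T),
        ∃ P : X →L[ℂ] X, P * P = P ∧
          FredholmType.piZero P ∈ FredholmType.bicommutant (FredholmType.piZero T) ∧
          FredholmType.IsRiesz (FredholmType.compression P T) ∧
          FredholmType.IsLeftSemiFredholm (FredholmType.compression (1 - P) T) ] ∧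
    (FredholmType.IsLeftGenDrazinZero T →
      ∃ R F : X →L[ℂ] X, T = R + F ∧ FredholmType.IsFiniteRank F ∧
        FredholmType.IsRieszLeftSemiFredholm R) := by
  open FredholmType in
  refine ⟨?_, ?_⟩
  · tfae_have 1 → 2 := by
      rintro ⟨P, h⟩
      exact ⟨⟨P, h.isLeftAssociatedCalkin⟩, P, h.isLeftAssociatedCalkin, h.mem_bicommutant⟩
    tfae_have 2 → 1 := by
      rintro ⟨-, P, h, hP⟩
      exact ⟨P, h.isLeftAssociatedZero hP⟩
    tfae_have 1 ↔ 3 := exists_congr fun P => isLeftAssociatedZero_iff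
    tfae_finish
  · rintro ⟨P, h⟩
    obtain ⟨hP, hb, h1, h2⟩ := isLeftAssociatedZero_iff.1 h
    exact ⟨P * T * P + (1 - P) * T * (1 - P), T - (P * T * P + (1 - P) * T * (1 - P)),
      (add_sub_cancel _ _).symm, isFiniteRank_sub_of_commute hP (commute_of_mem_bicommutant hb),
      isRieszLeftSemiFredholm_of_compression hP h1 h2⟩
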